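/- Let $E$ be a Euclidean space (a finite-dimensional real inner product space, e.g. $\mathbb{R}^n$). For $F\subset E$ let $P_F(x)=\operatorname{argmin}\{\|z-x\|: z\in F\}$ denote the (multivalued) projection, and for $F$ closed and $\bar x\in F$ let $$N_F(\bar x)=\Big\{\lim_i t_i(x_i-z_i)\;:\; t_i\ge 0,\ x_i\to\bar x,\ z_i\in P_F(x_i)\Big\}$$ denote the normal cone. Let $C\subset E$ be a closed set and let $\bar x\in C$. The set $C$ is *super-regular* at $\bar x$ if for every $\delta>0$ there is $\varepsilon>0$ such that $$\langle z-y,\,u-y\rangle\le \delta\,\|z-y\|\,\|u-y\|$$ for all $u\in E$ and $z\in C$ with $\|u-\bar x\|<\varepsilon$ and $\|z-\bar x\|<\varepsilon$, and all $y\in P_C(u)$. The set $C$ is *amenable* at $\bar x$ if there exist $\ell \geq 0$, an open neighbourhood $U$ of $\bar x$, a $C^1$ map $G:U\to\mathbb{R}^\ell$ and a closed convex set $D\subset\mathbb{R}^\ell$ containing $G(\bar x)$ such that $$N_D(G(\bar x))\cap\ker\big(\nabla G(\bar x)^*\big)=\{0\}$$ and such that all points $x$ sufficiently near $\bar x$ satisfy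 $x\in C$ if and only if $G(x)\in D$. **Proposition (amenable implies super-regular).** If $C$ is amenable at $\bar x$, then $C$ is super-regular at $\bar x$. In particular, suppose that there are finitely many real-valued functions $g_1,\dots,g_p,h_1,\dots,h_q$ ($p,q\ge 0$), each $C^1$ on an open neighbourhood of $\bar x$, such that all points $x$ sufficiently near $\bar x$ satisfy $x\in C$ if and only if $g_i(x)\le 0$ for all $i$ and $h_j(x)=0$ for all $j$. Suppose the Mangasarian–Fromovitz constraint qualification holds at $\bar x$: the gradients $\nabla h_1(\bar x),\dots,\nabla h_q(\bar x)$ are linearly independent, and there is a vector $d \in E$ with $\langle\nabla h_j(\bar x),d\rangle=0$ for all $j$ and $\langle\nabla g_i(\bar x),d\rangle<0$ for all $i$ with $g_i(\bar x)=0$. Then $C$ is amenable at $\bar x$, and hence super-regular at $\bar x$. -/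

import Mathlib

open Filter Topology

namespace SuperRegularity

/-- The multivalued projection `P_F(x) = argmin {‖z - x‖ : z ∈ F}`. -/
def proj {E : Type*} [NormedAddCommGroup E] (F : Set E) (x : E) : Set E :=
  {z | z ∈ F ∧ ∀ w ∈ F, ‖z - x‖ ≤ ‖w - x‖}

/-- The (limiting) normal cone to `F` at a point `a ∈ F`: all limits of sequences
`tᵢ (xᵢ - zᵢ)` with `tᵢ ≥ 0`, `xᵢ → a` and `zᵢ ∈ P_F(xᵢ)`. -/
def normalCone {E : Type*} [NormedAddCommGroup E] [InnerProductSpace ℝ E]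
    (F : Set E) (a : E) : Set E :=
  {v | ∃ (t : ℕ → ℝ) (x z : ℕ → E), (∀ i, 0 ≤ t i) ∧ Tendsto x atTop (𝓝 a) ∧
    (∀ i, z i ∈ proj F (x i)) ∧ Tendsto (fun i => t i • (x i - z i)) atTop (𝓝 v)}

/-- Super-regularity of a closed set `C` at a point `a ∈ C`. -/
def IsSuperRegularAt {E : Type*} [NormedAddCommGroup E] [InnerProductSpace ℝ E]
    (C : Set E) (a : E) : Prop :=
  ∀ δ : ℝ, 0 < δ → ∃ ε : ℝ, 0 < ε ∧ ∀ u z : E, ‖u - a‖ < ε → ‖z - a‖ < ε → z ∈ C →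
    ∀ y ∈ proj C u, inner ℝ (z - y) (u - y) ≤ δ * (‖z - y‖ * ‖u - y‖)

/-- Amenability of `C` at a point `a ∈ C`: near `a`, the set `C` is `G⁻¹(D)` with `G` a `C¹`
map on an open neighbourhood `U` of `a` (its values outside `U` play no role), `D` closed and
convex, and `N_D(G(a)) ∩ ker (∇G(a)*) = {0}`. -/
def IsAmenableAt {E : Type*} [NormedAddCommGroup E] [InnerProductSpace ℝ E]
    [FiniteDimensional ℝ E] (C : Set E) (a : E) : Prop :=
  ∃ (l : ℕ) (U : Set E) (G : E → EuclideanSpace ℝ (Fin l)) (D : Set (EuclideanSpace ℝ (Fin l))),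
    IsOpen U ∧ a ∈ U ∧ ContDiffOn ℝ 1 G U ∧ IsClosed D ∧ Convex ℝ D ∧ G a ∈ D ∧
    normalCone D (G a) ∩
      {w | LinearMap.adjoint (fderiv ℝ G a : E →ₗ[ℝ] EuclideanSpace ℝ (Fin l)) w = 0} = {0} ∧
    ∀ᶠ x in 𝓝 a, (x ∈ C ↔ G x ∈ D)

/-- Near `a`, the set `C` is described by finitely many `C¹` constraints `g i ≤ 0`, `h j = 0`
satisfying the Mangasarian–Fromovitz constraint qualification at `a`: the derivatives of the
equality constraints are linearly independent, and some direction `d` annihilates all of them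
while strictly decreasing (to first order) every active inequality constraint. -/
def IsMangasarianFromovitzAt {E : Type*} [NormedAddCommGroup E] [InnerProductSpace ℝ E]
    (C : Set E) (a : E) : Prop :=
  ∃ (p q : ℕ) (U : Set E) (g : Fin p → E → ℝ) (h : Fin q → E → ℝ),
    IsOpen U ∧ a ∈ U ∧ (∀ i, ContDiffOn ℝ 1 (g i) U) ∧ (∀ j, ContDiffOn ℝ 1 (h j) U) ∧
    (∀ᶠ x in 𝓝 a, (x ∈ C ↔ (∀ i, g i x ≤ 0) ∧ ∀ j, h j x = 0)) ∧
    LinearIndependent ℝ (fun j => fderiv ℝ (h j) a) ∧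
    ∃ d : E, (∀ j, fderiv ℝ (h j) a d = 0) ∧ ∀ i, g i a = 0 → fderiv ℝ (g i) a d < 0

end SuperRegularity

/-!
Near `a` write `C = G⁻¹(D)`. If a proximal normal `u - y` to `C` at `y` has the form `(∇G y)* w`
with `w` normal to the convex set `D` at `G y` and `‖w‖ ≤ ‖u - y‖ / c`, then
`⟪z - y, u - y⟫ = ⟪∇G y (z - y), w⟫`, which by uniform first-order approximation exceeds
`⟪G z - G y, w⟫ ≤ 0` by at most a small multiple of `‖z - y‖ ‖w‖`. This is super-regularity.

Exact multipliers, and hence a normal cone calculus, are not needed: minimising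
`‖x - u‖² + ‖x - y‖² + n dist(G x, D)²` near `y` produces points `x n → y` whose stationarity
conditions hold with approximate multipliers `w n` (`exists_penalty_sequence`). The bound on
`‖w n‖` comes from the constraint qualification, which by compactness of the unit sphere is stable
under perturbation (`exists_forall_mul_norm_le_norm_adjoint`). The inequality is proved at each
`x n` with no reference to a limit of the `w n`, and only `x n → y` is used to conclude.

Under the Mangasarian–Fromovitz condition, `D` is the set of vectors with the first `p` coordinates
nonpositive and the other `q` zero. A normal `w` to `D` satisfies the usual sign and
complementarity conditions; if `(∇G a)* w = 0`, pairing with `d` annihilates the inequality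
multipliers and linear independence annihilates the rest.
-/

namespace SuperRegularity

open Metric

/-! ### Normal cones to convex sets -/

section Cones

variable {F : Type*} [NormedAddCommGroup F] [InnerProductSpace ℝ F]

/-- The obtuse-angle characterisation of projections onto convex sets. -/
theorem mem_proj_iff_of_convex {K : Set F} (hK : Convex ℝ K) {x z : F} (hz : z ∈ K) :
    z ∈ proj K x ↔ ∀ v ∈ K, inner ℝ (x - z) (v - z) ≤ 0 := by
  rw [← norm_eq_iInf_iff_real_inner_le_zero hK hz]
  have : Nonempty K := ⟨⟨z, hz⟩⟩
  have hb : BddBelow (Set.range fun w : K => ‖x - w‖) :=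
    ⟨0, by rintro _ ⟨w, rfl⟩; exact norm_nonneg _⟩
  constructor
  · rintro ⟨-, h⟩
    refine le_antisymm (le_ciInf fun w => ?_) (ciInf_le hb ⟨z, hz⟩)
    rw [norm_sub_rev x z, norm_sub_rev x]
    exact h w w.2
  · intro h
    refine ⟨hz, fun w hw => ?_⟩
    rw [norm_sub_rev z x, norm_sub_rev w x, h]
    exact ciInf_le hb ⟨w, hw⟩

/-- For a convex set, the limiting normal cone is the normal cone of convex analysis. -/
theorem mem_normalCone_iff_of_convex {K : Set F} (hK : Convex ℝ K) {b : F} (hb : b ∈ K) {w : F} :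
    w ∈ normalCone K b ↔ ∀ v ∈ K, inner ℝ w (v - b) ≤ 0 := by
  constructor
  · rintro ⟨t, x, z, ht, hx, hz, hw⟩ v hv
    have hxz : Tendsto (fun i => z i - x i) atTop (𝓝 0) := by
      refine squeeze_zero_norm (fun i => (hz i).2 b hb) ?_
      simpa using (tendsto_const_nhds (x := b)).sub hx |>.norm
    have hzb : Tendsto z atTop (𝓝 b) := by
      simpa using hxz.add hx
    refine le_of_tendsto (hw.inner (tendsto_const_nhds.sub hzb)) (Eventually.of_forall fun i => ?_)
    rw [real_inner_smul_left]
    exact mul_nonpos_of_nonneg_of_nonpos (ht i)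
      ((mem_proj_iff_of_convex hK (hz i).1).1 (hz i) v hv)
  · intro h
    refine ⟨fun i => (i : ℝ) + 1, fun i => b + ((i : ℝ) + 1)⁻¹ • w, fun _ => b,
      fun i => by positivity, ?_, fun i => ?_, ?_⟩
    · have h0 : Tendsto (fun i : ℕ => ((i : ℝ) + 1)⁻¹) atTop (𝓝 0) := by
        simpa using tendsto_one_div_add_atTop_nhds_zero_nat (𝕜 := ℝ)
      simpa using (tendsto_const_nhds (x := b)).add (h0.smul_const w)
    · rw [mem_proj_iff_of_convex hK hb]
      intro v hv
      rw [add_sub_cancel_left, real_inner_smul_left]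
      exact mul_nonpos_of_nonneg_of_nonpos (by positivity) (h v hv)
    · refine tendsto_const_nhds.congr fun i => ?_
      rw [add_sub_cancel_left, smul_smul, mul_inv_cancel₀ (by positivity), one_smul]

end Cones

/-! ### Uniform first-order approximation -/

/-- A `C¹` map is approximated to first order uniformly in the base point. -/
theorem exists_forall_norm_sub_sub_fderiv_le {E F : Type*} [NormedAddCommGroup E]
    [NormedSpace ℝ E] [NormedAddCommGroup F] [NormedSpace ℝ F] {G : E → F} {a : E}
    (hG : ContDiffAt ℝ 1 G a) {η : ℝ} (hη : 0 < η) :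
    ∃ r > 0, ∀ x z, ‖x - a‖ < r → ‖z - a‖ < r →
      ‖G z - G x - fderiv ℝ G x (z - x)‖ ≤ η * ‖z - x‖ := by
  have hs := (hG.hasStrictFDerivAt (by norm_num)).isLittleO.def (half_pos hη)
  have hc : ContinuousAt (fderiv ℝ G) a := (hG.fderiv_right (m := 0) (by norm_num)).continuousAt
  obtain ⟨r₁, hr₁, h₁⟩ := Metric.eventually_nhds_iff.1 hs
  obtain ⟨r₂, hr₂, h₂⟩ := Metric.continuousAt_iff.1 hc _ (half_pos hη)
  refine ⟨min r₁ r₂, lt_min hr₁ hr₂, fun x z hx hz => ?_⟩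
  have e₁ := h₁ (y := (z, x)) (by
    rw [Prod.dist_eq, dist_eq_norm, dist_eq_norm]
    exact max_lt (hz.trans_le (min_le_left _ _)) (hx.trans_le (min_le_left _ _)))
  have e₂ := h₂ (x := x) (by
    rw [dist_eq_norm]
    exact hx.trans_le (min_le_right _ _))
  rw [dist_eq_norm] at e₂
  have e₃ := (fderiv ℝ G x - fderiv ℝ G a).le_of_opNorm_le e₂.le (z - x)
  have : G z - G x - fderiv ℝ G x (z - x) =
      (G z - G x - fderiv ℝ G a (z - x)) - (fderiv ℝ G x - fderiv ℝ G a) (z - x) := by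
    simp only [sub_apply]
    abel
  rw [this]
  calc _ ≤ η / 2 * ‖z - x‖ + η / 2 * ‖z - x‖ := (norm_sub_le _ _).trans (add_le_add e₁ e₃)
    _ = η * ‖z - x‖ := by ring

/-! ### Multipliers for nearest points of `G⁻¹(D)` -/

section Regularity

variable {E F : Type*} [NormedAddCommGroup E] [InnerProductSpace ℝ E] [FiniteDimensional ℝ E]
  [NormedAddCommGroup F] [InnerProductSpace ℝ F] [FiniteDimensional ℝ F]

/-- The constraint qualification is stable: if no nonzero normal to `D` at `b` lies in the kernel
of `(L a)*`, then `(L x)*` is uniformly bounded below on normals to `D` at points near `b`, for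
all `x` near `a`. -/
theorem exists_forall_mul_norm_le_norm_adjoint {L : E → E →L[ℝ] F} {a : E}
    (hL : ContinuousAt L a) {D : Set F} {b : F}
    (hq : ∀ w : F, (∀ v ∈ D, inner ℝ w (v - b) ≤ 0) →
      ContinuousLinearMap.adjoint (L a) w = 0 → w = 0) :
    ∃ c > 0, ∃ r > 0, ∀ x, ‖x - a‖ < r → ∀ v ∈ D, ‖v - b‖ < r → ∀ w : F,
      (∀ v' ∈ D, inner ℝ w (v' - v) ≤ 0) →
        c * ‖w‖ ≤ ‖ContinuousLinearMap.adjoint (L x) w‖ := by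
  by_contra! hcon
  have hpos : ∀ n : ℕ, (0 : ℝ) < 1 / ((n : ℝ) + 1) := fun n => by positivity
  choose x hx v hvD hv w hw hlt using fun n : ℕ => hcon _ (hpos n) _ (hpos n)
  have h0 := tendsto_one_div_add_atTop_nhds_zero_nat (𝕜 := ℝ)
  have hxa : Tendsto x atTop (𝓝 a) :=
    tendsto_iff_norm_sub_tendsto_zero.2
      (squeeze_zero (fun _ => norm_nonneg _) (fun n => (hx n).le) h0)
  have hvb : Tendsto v atTop (𝓝 b) :=
    tendsto_iff_norm_sub_tendsto_zero.2
      (squeeze_zero (fun _ => norm_nonneg _) (fun n => (hv n).le) h0)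
  have hwpos : ∀ n, 0 < ‖w n‖ := by
    intro n
    rw [norm_pos_iff]
    intro hz
    have := hlt n
    simp [hz] at this
  obtain ⟨w₀, hw₀, φ, hφ, hlim⟩ := (isCompact_sphere (0 : F) 1).tendsto_subseq
    (x := fun n => ‖w n‖⁻¹ • w n) (fun n => by
      simp [norm_smul, inv_mul_cancel₀ (hwpos n).ne'])
  have hφ' := hφ.tendsto_atTop
  have hnorm : ‖w₀‖ = 1 := by simpa using hw₀
  have hzero : w₀ = 0 := by
    refine hq w₀ (fun v' hv' => ?_) ?_
    · refine le_of_tendsto (hlim.inner (tendsto_const_nhds.sub (hvb.comp hφ')))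
        (Eventually.of_forall fun n => ?_)
      simp only [Function.comp_apply, real_inner_smul_left]
      exact mul_nonpos_of_nonneg_of_nonpos (by positivity) (hw _ v' hv')
    · have hadj : Tendsto (fun n => ContinuousLinearMap.adjoint (L (x (φ n)))) atTop
          (𝓝 (ContinuousLinearMap.adjoint (L a))) :=
        ((ContinuousLinearMap.adjoint (𝕜 := ℝ) (E := E) (F := F)).continuous.tendsto _).comp
          (hL.tendsto.comp (hxa.comp hφ'))
      refine tendsto_nhds_unique
        (((isBoundedBilinearMap_apply (𝕜 := ℝ) (E := F) (F := E)).continuous.tendsto _).comp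
          (hadj.prodMk_nhds hlim)) (squeeze_zero_norm (fun n => ?_)
        (h0.comp hφ'))
      simp only [Function.comp_apply, map_smul, norm_smul, norm_inv, norm_norm]
      rw [inv_mul_le_iff₀ (hwpos _), mul_comm]
      exact (hlt _).le
  simp [hzero] at hnorm

/-- The stationarity condition for the penalised problem, with multiplier `t (G x - v)`. -/
theorem adjoint_fderiv_eq_of_isLocalMin {G : E → F} {x y u : E} {v : F} {t : ℝ}
    (hG : DifferentiableAt ℝ G x)
    (hmin : IsLocalMin (fun x => ‖x - u‖ ^ 2 + ‖x - y‖ ^ 2 + t * ‖G x - v‖ ^ 2) x) :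
    ContinuousLinearMap.adjoint (fderiv ℝ G x) (t • (G x - v)) = u + y - (2 : ℝ) • x := by
  have d₁ := ((hasFDerivAt_id (𝕜 := ℝ) x).sub_const u).norm_sq
  have d₂ := ((hasFDerivAt_id (𝕜 := ℝ) x).sub_const y).norm_sq
  have d₃ := (hG.hasFDerivAt.sub_const v).norm_sq
  have h0 := hmin.hasFDerivAt_eq_zero ((d₁.add d₂).add (d₃.const_mul t))
  refine ext_inner_right ℝ fun p => ?_
  have hp := congrArg (fun T : E →L[ℝ] ℝ => T p) h0
  simp at hp
  rw [ContinuousLinearMap.adjoint_inner_left, real_inner_smul_left, inner_sub_left,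
    inner_sub_left, inner_add_left, real_inner_smul_left]
  linarith

/-- Approximate Lagrange multipliers by quadratic penalisation: if `y` is a local nearest point
to `u` in `G⁻¹(D)`, there are points `x n → y`, points `v n` of `D` at least as near to `G (x n)`
as `G y` is, and normals `w n` to `D` at `v n`, for which `(∇G (x n))* w n` tends to `u - y`. The
proof takes `v n` to be the projection of `G (x n)` and `w n` a nonnegative multiple of
`G (x n) - v n`. -/
theorem exists_penalty_sequence {G : E → F} {D : Set F} (hD : IsClosed D) (hconv : Convex ℝ D)
    {y u : E} {r : ℝ} (hr : 0 < r) (hG : ∀ x ∈ closedBall y r, DifferentiableAt ℝ G x)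
    (hy : G y ∈ D) (hmin : ∀ x ∈ closedBall y r, G x ∈ D → ‖y - u‖ ≤ ‖x - u‖) :
    ∃ (x : ℕ → E) (v w : ℕ → F), Tendsto x atTop (𝓝 y) ∧ ∀ᶠ n in atTop,
      v n ∈ D ∧ ‖G (x n) - v n‖ ≤ ‖G (x n) - G y‖ ∧
      (∀ v' ∈ D, inner ℝ (w n) (v' - v n) ≤ 0) ∧ inner ℝ (w n) (v n - G (x n)) ≤ 0 ∧
      ContinuousLinearMap.adjoint (fderiv ℝ G (x n)) (w n) = u + y - (2 : ℝ) • x n := by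
  have hGc : ContinuousOn G (closedBall y r) := fun x hx =>
    (hG x hx).continuousAt.continuousWithinAt
  have hdc : ContinuousOn (fun x => infDist (G x) D) (closedBall y r) :=
    (continuous_infDist_pt D).comp_continuousOn hGc
  have hyb : y ∈ closedBall y r := mem_closedBall_self hr.le
  choose x hxb hxmin using fun n : ℕ =>
    (isCompact_closedBall y r).exists_isMinOn ⟨y, hyb⟩
      (f := fun x => ‖x - u‖ ^ 2 + ‖x - y‖ ^ 2 + n * infDist (G x) D ^ 2)
      (by fun_prop)
  choose v hvD hv using fun n => hD.exists_infDist_eq_dist ⟨_, hy⟩ (G (x n))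
  have hval : ∀ n : ℕ, ‖x n - u‖ ^ 2 + ‖x n - y‖ ^ 2 + n * infDist (G (x n)) D ^ 2
      ≤ ‖y - u‖ ^ 2 := fun n => by
    simpa [infDist_zero_of_mem hy] using hxmin n hyb
  obtain ⟨x₀, hx₀, φ, hφ, hlim⟩ := (isCompact_closedBall y r).tendsto_subseq hxb
  have hφ' := hφ.tendsto_atTop
  have hdlim : Tendsto (fun n => infDist (G (x (φ n))) D) atTop (𝓝 (infDist (G x₀) D)) :=
    ((continuous_infDist_pt D).tendsto _).comp ((hG x₀ hx₀).continuousAt.tendsto.comp hlim)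
  -- The penalty term stays bounded, so the limit point is feasible.
  have hfeas : G x₀ ∈ D := by
    rw [hD.mem_iff_infDist_zero ⟨_, hy⟩]
    have hz : Tendsto (fun n => infDist (G (x (φ n))) D ^ 2) atTop (𝓝 0) := by
      have h0 : Tendsto (fun n : ℕ => ‖y - u‖ ^ 2 * (1 / (n : ℝ))) atTop (𝓝 0) := by
        simpa using (tendsto_one_div_atTop_nhds_zero_nat (𝕜 := ℝ)).const_mul (‖y - u‖ ^ 2)
      refine squeeze_zero' (Eventually.of_forall fun _ => sq_nonneg _) ?_ (h0.comp hφ')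
      filter_upwards [hφ'.eventually_gt_atTop 0] with n hn
      have hn' : (0 : ℝ) < φ n := by exact_mod_cast hn
      have := hval (φ n)
      simp only [Function.comp_apply]
      rw [mul_one_div, le_div_iff₀ hn']
      nlinarith [sq_nonneg ‖x (φ n) - u‖, sq_nonneg ‖x (φ n) - y‖]
    exact pow_eq_zero_iff two_ne_zero |>.1 (tendsto_nhds_unique (hdlim.pow 2) hz)
  -- Feasibility forces `x₀ = y`, thanks to the localising term `‖x - y‖ ^ 2`.
  have hx₀y : x₀ = y := by
    have h1 : ‖x₀ - u‖ ^ 2 + ‖x₀ - y‖ ^ 2 ≤ ‖y - u‖ ^ 2 := by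
      refine le_of_tendsto (((hlim.sub_const u).norm.pow 2).add ((hlim.sub_const y).norm.pow 2))
        (Eventually.of_forall fun n => ?_)
      have := hval (φ n)
      have : 0 ≤ (φ n : ℝ) * infDist (G (x (φ n))) D ^ 2 := by positivity
      simp only [Function.comp_apply]
      linarith
    have h2 := pow_le_pow_left₀ (norm_nonneg _) (hmin x₀ hx₀ hfeas) 2
    have h3 : ‖x₀ - y‖ ^ 2 = 0 := le_antisymm (by linarith) (sq_nonneg _)
    exact sub_eq_zero.1 (norm_eq_zero.1 (pow_eq_zero_iff two_ne_zero |>.1 h3))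
  rw [hx₀y] at hlim
  refine ⟨x ∘ φ, v ∘ φ, fun n => (φ n : ℝ) • (G (x (φ n)) - v (φ n)), hlim, ?_⟩
  filter_upwards [hlim (ball_mem_nhds y hr)] with n hn
  have hnear : ∀ d ∈ D, ‖G (x (φ n)) - v (φ n)‖ ≤ ‖G (x (φ n)) - d‖ := fun d hd => by
    rw [← dist_eq_norm, ← dist_eq_norm, ← hv]
    exact infDist_le_dist_of_mem hd
  have hproj : v (φ n) ∈ proj D (G (x (φ n))) := by
    refine ⟨hvD _, fun d hd => ?_⟩
    rw [norm_sub_rev, norm_sub_rev d]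
    exact hnear d hd
  refine ⟨hvD _, hnear _ hy, fun v' hv' => ?_, ?_, ?_⟩
  · rw [real_inner_smul_left]
    exact mul_nonpos_of_nonneg_of_nonpos (Nat.cast_nonneg _)
      ((mem_proj_iff_of_convex hconv (hvD _)).1 hproj v' hv')
  · simp only [Function.comp_apply]
    rw [real_inner_smul_left, ← neg_sub (G _), inner_neg_right, real_inner_self_eq_norm_sq]
    exact mul_nonpos_of_nonneg_of_nonpos (Nat.cast_nonneg _) (neg_nonpos.2 (sq_nonneg _))
  · refine adjoint_fderiv_eq_of_isLocalMin (hG _ (hxb _)) ?_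
    -- Freezing the projection `v` majorises the distance, with equality at the minimiser.
    filter_upwards [isOpen_ball.mem_nhds hn] with p hp
    have h1 := isMinOn_iff.1 (hxmin (φ n)) p (ball_subset_closedBall hp)
    have h2 : infDist (G p) D ≤ ‖G p - v (φ n)‖ := by
      rw [← dist_eq_norm]
      exact infDist_le_dist_of_mem (hvD _)
    have h3 := mul_le_mul_of_nonneg_left (pow_le_pow_left₀ infDist_nonneg h2 2)
      (Nat.cast_nonneg (α := ℝ) (φ n))
    have h4 := hv (φ n)
    rw [dist_eq_norm] at h4
    simp only [h4] at h1
    simp only [Function.comp_apply]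
    linarith

end Regularity

/-! ### Amenable sets are super-regular -/

section Amenable

variable {E : Type*} [NormedAddCommGroup E] [InnerProductSpace ℝ E] [FiniteDimensional ℝ E]

theorem IsAmenableAt.isSuperRegularAt {C : Set E} {a : E} (ha : a ∈ C) (h : IsAmenableAt C a) :
    IsSuperRegularAt C a := by
  obtain ⟨l, U, G, D, hU, haU, hGU, hD, hconv, hGa, hq, hCD⟩ := h
  have hGat : ∀ x ∈ U, ContDiffAt ℝ 1 G x := fun x hx => hGU.contDiffAt (hU.mem_nhds hx)
  have hLc : ContinuousAt (fderiv ℝ G) a :=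
    ((hGat a haU).fderiv_right (m := 0) (by norm_num)).continuousAt
  obtain ⟨c, hc, r₁, hr₁, hadj⟩ := exists_forall_mul_norm_le_norm_adjoint hLc (D := D) (b := G a)
    (fun w hw hw0 => by
      have : w ∈ ({0} : Set (EuclideanSpace ℝ (Fin l))) := by
        rw [← hq]
        refine ⟨(mem_normalCone_iff_of_convex hconv hGa).2 hw, ?_⟩
        refine ext_inner_right ℝ fun p => ?_
        rw [LinearMap.adjoint_inner_left, inner_zero_left]
        have := congrArg (fun e => inner ℝ e p) hw0
        simpa [ContinuousLinearMap.adjoint_inner_left] using this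
      simpa using this)
  intro δ hδ
  obtain ⟨r₂, hr₂, happ⟩ := exists_forall_norm_sub_sub_fderiv_le (hGat a haU) (mul_pos hδ hc)
  obtain ⟨r₃, hr₃, hCU⟩ := Metric.eventually_nhds_iff.1 (hCD.and (hU.eventually_mem haU))
  -- The factor `1 / 4` leaves room for the detour `v n → G (x n) → G y → G a` below.
  obtain ⟨r₄, hr₄, hGc⟩ := Metric.continuousAt_iff.1 (hGat a haU).continuousAt (r₁ / 4)
    (by positivity)
  set R := min (min r₁ r₂) (min r₃ r₄) with hR
  have hRpos : 0 < R := lt_min (lt_min hr₁ hr₂) (lt_min hr₃ hr₄)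
  have hR₁ : R ≤ r₁ := (min_le_left _ _).trans (min_le_left _ _)
  have hR₂ : R ≤ r₂ := (min_le_left _ _).trans (min_le_right _ _)
  have hR₃ : R ≤ r₃ := (min_le_right _ _).trans (min_le_left _ _)
  have hR₄ : R ≤ r₄ := (min_le_right _ _).trans (min_le_right _ _)
  -- Projections of `u` are within `2 ‖u - a‖` of `a`.
  refine ⟨R / 4, by positivity, fun u z hu hz hzC y hy => ?_⟩
  have hya : ‖y - a‖ < R / 2 := by
    have h1 := hy.2 a ha
    rw [norm_sub_rev a u] at h1
    have h2 : ‖y - a‖ ≤ ‖y - u‖ + ‖u - a‖ := norm_sub_le_norm_sub_add_norm_sub y u a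
    linarith
  have hnear : ∀ x ∈ closedBall y (R / 4), ‖x - a‖ < R := fun x hx => by
    rw [mem_closedBall, dist_eq_norm] at hx
    have h2 : ‖x - a‖ ≤ ‖x - y‖ + ‖y - a‖ := norm_sub_le_norm_sub_add_norm_sub x y a
    linarith
  have hCU' : ∀ x, ‖x - a‖ < R → (x ∈ C ↔ G x ∈ D) ∧ x ∈ U := fun x hx =>
    hCU (by rw [dist_eq_norm]; exact hx.trans_le hR₃)
  have hGc' : ∀ x, ‖x - a‖ < R → ‖G x - G a‖ < r₁ / 4 := fun x hx => by
    rw [← dist_eq_norm]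
    exact hGc (by rw [dist_eq_norm]; exact hx.trans_le hR₄)
  have hyR : ‖y - a‖ < R := by linarith
  have hzR : ‖z - a‖ < R := by linarith
  have hGz : G z ∈ D := (hCU' z hzR).1.1 hzC
  obtain ⟨x, v, w, hx, hall⟩ := exists_penalty_sequence hD hconv (y := y) (u := u)
    (r := R / 4) (by positivity)
    (fun x hx => (hGat x (hCU' x (hnear x hx)).2).differentiableAt (by norm_num))
    ((hCU' y hyR).1.1 hy.1) (fun x hx hxD => hy.2 x ((hCU' x (hnear x hx)).1.2 hxD))
  have key : ∀ᶠ n in atTop, inner ℝ (z - x n) (u + y - (2 : ℝ) • x n) ≤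
      δ * (‖z - x n‖ * ‖u + y - (2 : ℝ) • x n‖) := by
    filter_upwards [hall, hx (closedBall_mem_nhds y (by positivity : 0 < R / 4))]
      with n ⟨hvD, hvG, hwn, hwG, hwadj⟩ hxn
    have hxR := hnear _ hxn
    have hvb : ‖v n - G a‖ < r₁ := by
      have h1 := hGc' _ hxR
      have h2 := hGc' _ hyR
      have h3 : ‖v n - G a‖ ≤ ‖v n - G (x n)‖ + ‖G (x n) - G a‖ :=
        norm_sub_le_norm_sub_add_norm_sub _ _ _
      have h4 : ‖G (x n) - G y‖ ≤ ‖G (x n) - G a‖ + ‖G a - G y‖ :=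
        norm_sub_le_norm_sub_add_norm_sub _ _ _
      rw [norm_sub_rev] at hvG
      rw [norm_sub_rev (G a)] at h4
      linarith
    have hcw := hadj _ (hxR.trans_le hR₁) _ hvD hvb _ hwn
    have hap := happ _ _ (hxR.trans_le hR₂) (hzR.trans_le hR₂)
    rw [← hwadj, real_inner_comm, ContinuousLinearMap.adjoint_inner_left]
    set T := fderiv ℝ G (x n)
    have hsplit : T (z - x n) = (G z - v n) + (v n - G (x n)) -
        (G z - G (x n) - T (z - x n)) := by abel
    have hle : inner ℝ (w n) (T (z - x n)) ≤ ‖w n‖ * (δ * c * ‖z - x n‖) := by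
      have h1 := hwn _ hGz
      have h2 : -inner ℝ (w n) (G z - G (x n) - T (z - x n)) ≤ ‖w n‖ * (δ * c * ‖z - x n‖) :=
        ((neg_le_abs _).trans (abs_real_inner_le_norm _ _)).trans
          (mul_le_mul_of_nonneg_left hap (norm_nonneg _))
      rw [hsplit, inner_sub_right, inner_add_right]
      linarith
    calc _ ≤ ‖w n‖ * (δ * c * ‖z - x n‖) := hle
      _ = δ * (‖z - x n‖ * (c * ‖w n‖)) := by ring
      _ ≤ _ := by gcongr
  have hlim₁ : Tendsto (fun n => z - x n) atTop (𝓝 (z - y)) := tendsto_const_nhds.sub hx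
  have hlim₂ : Tendsto (fun n => u + y - (2 : ℝ) • x n) atTop (𝓝 (u - y)) := by
    have : u - y = u + y - (2 : ℝ) • y := by rw [two_smul]; abel
    rw [this]
    exact tendsto_const_nhds.sub (hx.const_smul 2)
  exact le_of_tendsto_of_tendsto (hlim₁.inner hlim₂)
    ((hlim₁.norm.mul hlim₂.norm).const_mul δ) key

/-! ### The Mangasarian–Fromovitz condition gives amenability -/

/-- The model set `{v | vᵢ ≤ 0 for i < p, vⱼ = 0 for j ≥ p}` for inequality and equality
constraints. -/
def constraintSet (p q : ℕ) : Set (EuclideanSpace ℝ (Fin (p + q))) :=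
  {v | (∀ i : Fin p, v (Fin.castAdd q i) ≤ 0) ∧ ∀ j : Fin q, v (Fin.natAdd p j) = 0}

theorem isClosed_constraintSet (p q : ℕ) : IsClosed (constraintSet p q) := by
  simp only [constraintSet, Set.ofPred_and, Set.ofPred_forall]
  exact (isClosed_iInter fun i => isClosed_le (by fun_prop) continuous_const).inter
    (isClosed_iInter fun j => isClosed_eq (by fun_prop) continuous_const)

theorem convex_constraintSet (p q : ℕ) : Convex ℝ (constraintSet p q) := by
  rintro x ⟨hx, hx'⟩ y ⟨hy, hy'⟩ s t hs ht -
  refine ⟨fun i => ?_, fun j => ?_⟩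
  · simpa using add_nonpos (mul_nonpos_of_nonneg_of_nonpos hs (hx i))
      (mul_nonpos_of_nonneg_of_nonpos ht (hy i))
  · simp [hx', hy']

/-- Sign and complementarity conditions on normals to the constraint set. -/
theorem nonneg_and_eq_zero_of_normal_constraintSet {p q : ℕ}
    {b w : EuclideanSpace ℝ (Fin (p + q))} (hb : b ∈ constraintSet p q)
    (hw : ∀ v ∈ constraintSet p q, inner ℝ w (v - b) ≤ 0) (i : Fin p) :
    0 ≤ w (Fin.castAdd q i) ∧ (b (Fin.castAdd q i) ≠ 0 → w (Fin.castAdd q i) = 0) := by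
  have hmove : ∀ s : ℝ, b (Fin.castAdd q i) + s ≤ 0 → s * w (Fin.castAdd q i) ≤ 0 := by
    intro s hs
    have := hw (b + EuclideanSpace.single (Fin.castAdd q i) s) ⟨fun k => ?_, fun j => ?_⟩
    · simpa [EuclideanSpace.inner_single_right] using this
    · by_cases hk : k = i
      · subst hk; simpa using hs
      · have : Fin.castAdd q k ≠ Fin.castAdd q i := fun h => hk (Fin.castAdd_injective _ _ h)
        simpa [this] using hb.1 k
    · have : Fin.natAdd p j ≠ Fin.castAdd q i := by
        intro h
        have := congrArg Fin.val h
        simp at this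
        omega
      simpa [this] using hb.2 j
  have hbi := hb.1 i
  have h1 := hmove (-1) (by linarith)
  refine ⟨by linarith, fun hne => ?_⟩
  have hlt : b (Fin.castAdd q i) < 0 := lt_of_le_of_ne hbi hne
  have h2 := hmove (-b (Fin.castAdd q i)) (by linarith)
  nlinarith

theorem IsMangasarianFromovitzAt.isAmenableAt {C : Set E} {a : E} (ha : a ∈ C)
    (hMF : IsMangasarianFromovitzAt C a) : IsAmenableAt C a := by
  obtain ⟨p, q, U, g, h, hU, haU, hg, hh, hC, hli, d, hd, hdg⟩ := hMF
  set G : E → EuclideanSpace ℝ (Fin (p + q)) := fun x =>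
    WithLp.toLp 2 (Fin.append (fun i => g i x) (fun j => h j x)) with hGdef
  have hGg : ∀ x i, G x (Fin.castAdd q i) = g i x := fun x i => by simp [hGdef]
  have hGh : ∀ x j, G x (Fin.natAdd p j) = h j x := fun x j => by simp [hGdef]
  have hmem : ∀ x, G x ∈ constraintSet p q ↔ (∀ i, g i x ≤ 0) ∧ ∀ j, h j x = 0 := fun x => by
    simp only [constraintSet, Set.mem_ofPred_eq, hGg, hGh]
  have hGU : ContDiffOn ℝ 1 G U := by
    rw [contDiffOn_euclidean]
    intro k
    refine Fin.addCases (fun i => ?_) (fun j => ?_) k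
    · simpa only [hGg] using hg i
    · simpa only [hGh] using hh j
  have hGd : DifferentiableAt ℝ G a :=
    (hGU.contDiffAt (hU.mem_nhds haU)).differentiableAt (by norm_num)
  have hcoord : ∀ k e, fderiv ℝ G a e k = fderiv ℝ (fun x => G x k) a e := fun k e => by
    have := ((EuclideanSpace.proj (𝕜 := ℝ) k).hasFDerivAt (x := G a)).comp a hGd.hasFDerivAt
    exact (congrArg (fun T : E →L[ℝ] ℝ => T e) this.fderiv).symm
  have hGa : G a ∈ constraintSet p q := (hmem a).2 (hC.self_of_nhds.1 ha)
  refine ⟨p + q, U, G, constraintSet p q, hU, haU, hGU, isClosed_constraintSet p q,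
    convex_constraintSet p q, hGa, ?_, hC.mono fun x hx => hx.trans (hmem x).symm⟩
  refine Set.Subset.antisymm ?_ ?_
  · rintro w ⟨hw, hw0⟩
    rw [mem_normalCone_iff_of_convex (convex_constraintSet p q) hGa] at hw
    have hsign := nonneg_and_eq_zero_of_normal_constraintSet hGa hw
    simp only [hGg] at hsign
    have hsum : ∀ e, ∑ i, w (Fin.castAdd q i) * fderiv ℝ (g i) a e +
        ∑ j, w (Fin.natAdd p j) * fderiv ℝ (h j) a e = 0 := fun e => by
      have h1 := congrArg (fun x => inner ℝ x e) hw0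
      simp only [LinearMap.adjoint_inner_left, inner_zero_left, ContinuousLinearMap.coe_coe] at h1
      rw [PiLp.inner_apply, Fin.sum_univ_add] at h1
      simpa [hcoord, hGg, hGh, mul_comm] using h1
    -- Testing against `d` kills the multipliers of the active inequalities.
    have hwi : ∀ i, w (Fin.castAdd q i) = 0 := by
      have hterm : ∀ i, w (Fin.castAdd q i) * fderiv ℝ (g i) a d ≤ 0 := fun i => by
        by_cases hi : g i a = 0
        · exact mul_nonpos_of_nonneg_of_nonpos (hsign i).1 (hdg i hi).le
        · simp [(hsign i).2 hi]
      have hz := hsum d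
      simp only [hd, mul_zero, Finset.sum_const_zero, add_zero] at hz
      intro i
      by_cases hi : g i a = 0
      · have := (Finset.sum_eq_zero_iff_of_nonpos fun i _ => hterm i).1 hz i (Finset.mem_univ i)
        exact (mul_eq_zero.1 this).resolve_right (hdg i hi).ne
      · exact (hsign i).2 hi
    have hwj : ∀ j, w (Fin.natAdd p j) = 0 := by
      refine Fintype.linearIndependent_iff.1 hli (fun j => w (Fin.natAdd p j)) ?_
      ext e
      simpa [hwi] using hsum e
    rw [Set.mem_singleton_iff]
    ext k
    exact Fin.addCases hwi hwj k
  · rintro w rfl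
    refine ⟨(mem_normalCone_iff_of_convex (convex_constraintSet p q) hGa).2 ?_, ?_⟩
    · simp
    · simp

end Amenable

end SuperRegularity

theorem mainTheorem9 {E : Type*} [NormedAddCommGroup E] [InnerProductSpace ℝ E]
    [FiniteDimensional ℝ E] (C : Set E) (hC : IsClosed C) (a : E) (ha : a ∈ C) :
    (SuperRegularity.IsAmenableAt C a → SuperRegularity.IsSuperRegularAt C a) ∧
    (SuperRegularity.IsMangasarianFromovitzAt C a →
      SuperRegularity.IsAmenableAt C a ∧ SuperRegularity.IsSuperRegularAt C a) :=
  ⟨fun h => h.isSuperRegularAt ha,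
    fun h => ⟨h.isAmenableAt ha, (h.isAmenableAt ha).isSuperRegularAt ha⟩⟩
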